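/- Let $\mathcal A$ be an abelian category with enough projectives, and let $\operatorname{proj}\mathcal A$ denote its projective objects. An object $X$ of $\mathcal A$ is Gorenstein projective if there is an acyclic complex $\mathbf P=(\cdots\to P_1\to P_0\xrightarrow{f}P_{-1}\to\cdots)$ of projective objects such that $X\cong\operatorname{Im} f$ and $\operatorname{Hom}_{\mathcal A}(\mathbf P,Q)$ is acyclic for every projective object $Q$. Let $\operatorname{Gproj}\mathcal A$ be the full subcategory of Gorenstein projective objects, and let $\mathcal S$ be the class of sequences $X\to Y\to Z$ in $\operatorname{Gproj}\mathcal A$ that are short exact in $\mathcal A$. A nonempty full subcategory $\mathcal D$ of $\operatorname{Gproj}\mathcal A$ is complete if, for every sequence $X\to Y\to Z$ in $\mathcal S$, whenever two of $X,Y,Z$ lie in $\mathcal D$, so does the third. It is thick if it is moreover closed under direct summands (that is, if $Y\to X\to Y$ is the identity of $Y$ and $X\in\mathcal D$, then $Y\in\mathcal D$). Then $(\operatorname{Gproj}\mathcal A,\mathcal S)$ is a Frobenius category. Let $\underline{\operatorname{Gproj}}\,\mathcal A$ be its stable category, that is, the quotient of $\operatorname{Gproj}\mathcal A$ by the ideal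 of the morphisms that factor through an $\mathcal S$-injective object, with its standard triangulation: choose for each $X$ a sequence $X\to I\to TX$ in $\mathcal S$ with $I$ an $\mathcal S$-injective object. This defines the shift functor $T$, and the distinguished triangles are those isomorphic to the image of a triangle $X\xrightarrow{f}Y\xrightarrow{g}C\xrightarrow{h}TX$ in which $C$ is the pushout of $X\to I$ and $f$, the sequence $Y\xrightarrow{g}C\xrightarrow{h}TX$ is in $\mathcal S$, and $I\to C\xrightarrow{h}TX$ is the chosen morphism $I\to TX$. A nonempty full subcategory of $\underline{\operatorname{Gproj}}\,\mathcal A$ is triangulated if, for every distinguished triangle $X\to Y\to Z\to TX$, whenever two of $X,Y,Z$ lie in it, so does the third; it is thick triangulated if it is moreover closed under direct summands. For a full subcategory $\mathcal D$ of $\operatorname{Gproj}\mathcal A$ let $F\mathcal D$ be the full subcategory of $\underline{\operatorname{Gproj}}\,\mathcal A$ with the same objects, and for a full subcategory $\mathcal D'$ of $\underline{\operatorname{Gproj}}\,\mathcal A$ let $G\mathcal D'$ be the full subcategory of $\operatorname{Gproj}\mathcal A$ with the same objects. Then $F$ and $G$ restrict to mutually inverse bijections 1. between the thick subcategories of $\operatorname{Gproj}\mathcal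 A$ containing $\operatorname{proj}\mathcal A$ and the thick triangulated subcategories of $\underline{\operatorname{Gproj}}\,\mathcal A$; 2. between the complete subcategories of $\operatorname{Gproj}\mathcal A$ containing $\operatorname{proj}\mathcal A$ and the triangulated subcategories of $\underline{\operatorname{Gproj}}\,\mathcal A$. -/

import Mathlib

open CategoryTheory CategoryTheory.Limits

universe v u

namespace Gproj

/-! ### Exact categories -/

section Exact

variable {E : Type u} [Category.{v} E] [Preadditive E]

/-- The admissible monomorphisms of a family `S` of short sequences. -/
def AdmissibleMono (S : ObjectProperty (ShortComplex E)) {X Y : E} (f : X ⟶ Y) : Prop :=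
  ∃ (Z : E) (g : Y ⟶ Z) (w : f ≫ g = 0), S (ShortComplex.mk f g w)

/-- The admissible epimorphisms of a family `S` of short sequences. -/
def AdmissibleEpi (S : ObjectProperty (ShortComplex E)) {Y Z : E} (g : Y ⟶ Z) : Prop :=
  ∃ (X : E) (f : X ⟶ Y) (w : f ≫ g = 0), S (ShortComplex.mk f g w)

/-- `S` is an exact structure on the category `E`; that `E` is additive is part of it. -/
structure IsExactStructure (S : ObjectProperty (ShortComplex E)) : Prop where
  hasZeroObject : HasZeroObject E
  hasFiniteBiproducts : HasFiniteBiproducts E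
  /-- In `X ⟶ Y ⟶ Z` in `S`, the first morphism is a kernel of the second. -/
  kernel : ∀ T : ShortComplex E, S T → Nonempty (IsLimit (KernelFork.ofι T.f T.zero))
  /-- In `X ⟶ Y ⟶ Z` in `S`, the second morphism is a cokernel of the first. -/
  cokernel : ∀ T : ShortComplex E, S T → Nonempty (IsColimit (CokernelCofork.ofπ T.g T.zero))
  of_iso : ∀ T T' : ShortComplex E, (T ≅ T') → S T → S T'
  /-- The identity of a zero object is an admissible epimorphism. -/
  ex0 : ∀ Z : E, IsZero Z → AdmissibleEpi S (𝟙 Z)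
  /-- Admissible epimorphisms are closed under composition. -/
  ex1 : ∀ {X Y Z : E} (f : X ⟶ Y) (g : Y ⟶ Z),
    AdmissibleEpi S f → AdmissibleEpi S g → AdmissibleEpi S (f ≫ g)
  /-- Admissible epimorphisms have pullbacks along all morphisms, and these are
  admissible epimorphisms. -/
  ex2 : ∀ {B C C' : E} (g : B ⟶ C) (h : C' ⟶ C), AdmissibleEpi S g →
    ∃ (B' : E) (h' : B' ⟶ B) (g' : B' ⟶ C'), IsPullback h' g' g h ∧ AdmissibleEpi S g'
  /-- Admissible monomorphisms have pushouts along all morphisms, and these are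
  admissible monomorphisms. -/
  ex2_op : ∀ {A B A' : E} (f : A ⟶ B) (h : A ⟶ A'), AdmissibleMono S f →
    ∃ (B' : E) (h' : B ⟶ B') (f' : A' ⟶ B'), IsPushout f h h' f' ∧ AdmissibleMono S f'

/-- Projective objects relative to the exact structure `S`. -/
def RelProjective (S : ObjectProperty (ShortComplex E)) (P : E) : Prop :=
  ∀ {Y Z : E} (g : Y ⟶ Z) (a : P ⟶ Z), AdmissibleEpi S g → ∃ b : P ⟶ Y, b ≫ g = a

/-- Injective objects relative to the exact structure `S`. -/
def RelInjective (S : ObjectProperty (ShortComplex E)) (I : E) : Prop :=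
  ∀ {X Y : E} (f : X ⟶ Y) (a : X ⟶ I), AdmissibleMono S f → ∃ b : Y ⟶ I, f ≫ b = a

/-- `(E, S)` is a Frobenius category. -/
structure IsFrobenius (S : ObjectProperty (ShortComplex E)) : Prop extends
    IsExactStructure S where
  enoughProjectives : ∀ X : E, ∃ (P : E) (g : P ⟶ X), RelProjective S P ∧ AdmissibleEpi S g
  enoughInjectives : ∀ X : E, ∃ (I : E) (f : X ⟶ I), RelInjective S I ∧ AdmissibleMono S f
  projective_iff_injective : ∀ X : E, RelProjective S X ↔ RelInjective S X

/-! ### Complete and thick subcategories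

A full subcategory is given by its class of objects, an `ObjectProperty`. -/

/-- Complete subcategories: nonempty, with the 2 out of 3 property for sequences in `S`. -/
structure IsComplete (S : ObjectProperty (ShortComplex E)) (D : ObjectProperty E) : Prop where
  nonempty : ∃ X, D X
  two_of_three : ∀ T : ShortComplex E, S T →
    (D T.X₁ → D T.X₂ → D T.X₃) ∧ (D T.X₁ → D T.X₃ → D T.X₂) ∧ (D T.X₂ → D T.X₃ → D T.X₁)

/-- Closure under direct summands: if `Y ⟶ X ⟶ Y` is the identity and `X` is in `D`,
then so is `Y`. -/
def ClosedUnderSummands {C : Type u} [Category.{v} C] (D : ObjectProperty C) : Prop :=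
  ∀ {X Y : C} (i : Y ⟶ X) (p : X ⟶ Y), i ≫ p = 𝟙 Y → D X → D Y

/-- Thick subcategories. -/
structure IsThick (S : ObjectProperty (ShortComplex E)) (D : ObjectProperty E) : Prop extends
    IsComplete S D where
  summands : ClosedUnderSummands D

/-! ### The stable category -/

/-- Two morphisms are identified when their difference factors through an injective object. -/
def stableRel (S : ObjectProperty (ShortComplex E)) : HomRel E := fun X Y f g =>
  ∃ (J : E) (a : X ⟶ J) (b : J ⟶ Y), RelInjective S J ∧ f - g = a ≫ b

/-- The stable category, the quotient of `E` by the ideal of the morphisms that factor through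
an injective object. -/
abbrev Stable (S : ObjectProperty (ShortComplex E)) : Type u := CategoryTheory.Quotient (stableRel S)

/-- The quotient functor to the stable category. -/
abbrev toStable (S : ObjectProperty (ShortComplex E)) : E ⥤ Stable S :=
  CategoryTheory.Quotient.functor (stableRel S)

/-- A sequence `X ⟶ I ⟶ X'` in `S` with `I` injective. -/
structure Cosyzygy (S : ObjectProperty (ShortComplex E)) (X : E) where
  I : E
  X' : E
  μ : X ⟶ I
  π : I ⟶ X'
  zero : μ ≫ π = 0
  mem : S (ShortComplex.mk μ π zero)
  injective : RelInjective S I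

variable {S : ObjectProperty (ShortComplex E)}

theorem IsFrobenius.nonempty_cosyzygy (hS : IsFrobenius S) (X : E) : Nonempty (Cosyzygy S X) := by
  obtain ⟨I, μ, hI, X', π, w, h⟩ := hS.enoughInjectives X
  exact ⟨⟨I, X', μ, π, w, h, hI⟩⟩

/-- The chosen sequence `X ⟶ I ⟶ TX`. -/
noncomputable def IsFrobenius.cosyzygy (hS : IsFrobenius S) (X : E) : Cosyzygy S X :=
  (hS.nonempty_cosyzygy X).some

/-- The morphisms `X' ⟶ Y'` completing `f` to a morphism from the sequence `X ⟶ I ⟶ X'` to the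
sequence `Y ⟶ J ⟶ Y'`. -/
def Cosyzygy.IsExtension {X Y : E} (c : Cosyzygy S X) (d : Cosyzygy S Y) (f : X ⟶ Y)
    (f' : c.X' ⟶ d.X') : Prop :=
  ∃ F : c.I ⟶ d.I, c.μ ≫ F = f ≫ d.μ ∧ c.π ≫ f' = F ≫ d.π

theorem IsFrobenius.exists_desc (hS : IsFrobenius S) {X W : E} (c : Cosyzygy S X) (k : c.I ⟶ W)
    (hk : c.μ ≫ k = 0) : ∃ l : c.X' ⟶ W, c.π ≫ l = k := by
  obtain ⟨hc⟩ := hS.cokernel _ c.mem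
  obtain ⟨l, hl⟩ := CokernelCofork.IsColimit.desc' hc k hk
  exact ⟨l, hl⟩

theorem IsFrobenius.π_cancel (hS : IsFrobenius S) {X W : E} (c : Cosyzygy S X) {k l : c.X' ⟶ W}
    (h : c.π ≫ k = c.π ≫ l) : k = l := by
  obtain ⟨hc⟩ := hS.cokernel _ c.mem
  exact Cofork.IsColimit.hom_ext hc h

theorem IsFrobenius.exists_isExtension (hS : IsFrobenius S) {X Y : E} (c : Cosyzygy S X)
    (d : Cosyzygy S Y) (f : X ⟶ Y) : ∃ f' : c.X' ⟶ d.X', c.IsExtension d f f' := by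
  obtain ⟨F, hF⟩ := d.injective c.μ (f ≫ d.μ) ⟨_, _, _, c.mem⟩
  obtain ⟨f', hf'⟩ := hS.exists_desc c (F ≫ d.π) (by
    rw [← Category.assoc, hF, Category.assoc, d.zero, comp_zero])
  exact ⟨f', F, hF, hf'⟩

theorem IsFrobenius.isExtension_unique (hS : IsFrobenius S) {X Y : E} {c : Cosyzygy S X}
    {d : Cosyzygy S Y} {f g : X ⟶ Y} (hfg : stableRel S f g) {f' g' : c.X' ⟶ d.X'}
    (hf : c.IsExtension d f f') (hg : c.IsExtension d g g') :
    (toStable S).map f' = (toStable S).map g' := by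
  obtain ⟨F, hF, hF'⟩ := hf
  obtain ⟨G, hG, hG'⟩ := hg
  obtain ⟨J, a, b, hJ, hab⟩ := hfg
  obtain ⟨a', ha'⟩ := hJ c.μ a ⟨_, _, _, c.mem⟩
  obtain ⟨k, hk⟩ := hS.exists_desc c (F - G - a' ≫ b ≫ d.μ) (by
    have h1 : f ≫ d.μ - g ≫ d.μ = a ≫ b ≫ d.μ := by
      rw [← Preadditive.sub_comp, hab, Category.assoc]
    rw [Preadditive.comp_sub, Preadditive.comp_sub, hF, hG, h1, ← Category.assoc c.μ, ha', sub_self])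
  refine CategoryTheory.Quotient.sound _ ⟨d.I, k, d.π, d.injective, hS.π_cancel c ?_⟩
  rw [Preadditive.comp_sub, hF', hG', ← Category.assoc, hk]
  simp [Preadditive.sub_comp, d.zero]

theorem stableRel_refl (hS : IsFrobenius S) {X Y : E} (f : X ⟶ Y) : stableRel S f f := by
  obtain ⟨c⟩ := hS.nonempty_cosyzygy X
  exact ⟨c.I, c.μ, 0, c.injective, by simp⟩

/-- The shift `T`, as a functor to the stable category. -/
noncomputable def IsFrobenius.preShift (hS : IsFrobenius S) : E ⥤ Stable S where
  obj X := (toStable S).obj (hS.cosyzygy X).X'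
  map {X Y} f := (toStable S).map
    (hS.exists_isExtension (hS.cosyzygy X) (hS.cosyzygy Y) f).choose
  map_id X := by
    rw [← (toStable S).map_id]
    exact hS.isExtension_unique (stableRel_refl hS (𝟙 X))
      (hS.exists_isExtension _ _ (𝟙 X)).choose_spec ⟨𝟙 _, by simp, by simp⟩
  map_comp {X Y Z} f g := by
    rw [← (toStable S).map_comp]
    refine hS.isExtension_unique (stableRel_refl hS (f ≫ g))
      (hS.exists_isExtension _ _ (f ≫ g)).choose_spec ?_
    obtain ⟨F, hF, hF'⟩ := (hS.exists_isExtension (hS.cosyzygy X) (hS.cosyzygy Y) f).choose_spec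
    obtain ⟨G, hG, hG'⟩ := (hS.exists_isExtension (hS.cosyzygy Y) (hS.cosyzygy Z) g).choose_spec
    refine ⟨F ≫ G, ?_, ?_⟩
    · rw [← Category.assoc, hF, Category.assoc, hG, Category.assoc]
    · rw [← Category.assoc, hF', Category.assoc, hG', Category.assoc]

/-- The shift functor `T` of the stable category: `TX` is the end term of the chosen sequence
`X ⟶ I ⟶ TX`, and `T` of the class of `f : X ⟶ Y` is the class of any `TX ⟶ TY` that completes
`f` to a morphism between the chosen sequences. -/
noncomputable def IsFrobenius.shift (hS : IsFrobenius S) : Stable S ⥤ Stable S :=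
  CategoryTheory.Quotient.lift (stableRel S) hS.preShift fun X Y f g hfg =>
    hS.isExtension_unique hfg
      (hS.exists_isExtension (hS.cosyzygy X) (hS.cosyzygy Y) f).choose_spec
      (hS.exists_isExtension (hS.cosyzygy X) (hS.cosyzygy Y) g).choose_spec

/-- `X ⟶ Y ⟶ C ⟶ TX` in `E` is a standard triangle: `C` is the pushout of `X ⟶ I` and
`f : X ⟶ Y`, and `Y ⟶ C ⟶ TX` in `S` is such that `I ⟶ C ⟶ TX` is the chosen `I ⟶ TX`. -/
def IsFrobenius.IsStandardTriangle (hS : IsFrobenius S) {X Y C : E} (f : X ⟶ Y) (g : Y ⟶ C)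
    (h : C ⟶ (hS.cosyzygy X).X') : Prop :=
  ∃ (f' : (hS.cosyzygy X).I ⟶ C) (w : g ≫ h = 0),
    IsPushout (hS.cosyzygy X).μ f f' g ∧ f' ≫ h = (hS.cosyzygy X).π ∧
      S (ShortComplex.mk g h w)

/-- The distinguished triangles of the stable category: the triangles isomorphic to the image of
a standard triangle. -/
def IsFrobenius.IsDistinguished (hS : IsFrobenius S) {X Y Z : Stable S} (f : X ⟶ Y) (g : Y ⟶ Z)
    (h : Z ⟶ hS.shift.obj X) : Prop :=
  ∃ (X₀ Y₀ C₀ : E) (f₀ : X₀ ⟶ Y₀) (g₀ : Y₀ ⟶ C₀) (h₀ : C₀ ⟶ (hS.cosyzygy X₀).X')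
    (φ₁ : X ≅ (toStable S).obj X₀) (φ₂ : Y ≅ (toStable S).obj Y₀)
    (φ₃ : Z ≅ (toStable S).obj C₀),
    hS.IsStandardTriangle f₀ g₀ h₀ ∧
      f ≫ φ₂.hom = φ₁.hom ≫ (toStable S).map f₀ ∧
      g ≫ φ₃.hom = φ₂.hom ≫ (toStable S).map g₀ ∧
      h ≫ hS.shift.map φ₁.hom = φ₃.hom ≫ (toStable S).map h₀

/-- Triangulated subcategories of the stable category: nonempty, with the 2 out of 3 property for
distinguished triangles. -/
structure IsTriangulatedSub (hS : IsFrobenius S) (D : ObjectProperty (Stable S)) : Prop where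
  nonempty : ∃ X, D X
  two_of_three : ∀ {X Y Z : Stable S} (f : X ⟶ Y) (g : Y ⟶ Z) (h : Z ⟶ hS.shift.obj X),
    hS.IsDistinguished f g h → (D X → D Y → D Z) ∧ (D X → D Z → D Y) ∧ (D Y → D Z → D X)

/-- Thick triangulated subcategories of the stable category. -/
structure IsThickTriangulatedSub (hS : IsFrobenius S) (D : ObjectProperty (Stable S)) : Prop
    extends IsTriangulatedSub hS D where
  summands : ClosedUnderSummands D

/-- `F D`: the full subcategory of the stable category with the same objects as `D`. -/
def subToStable (S : ObjectProperty (ShortComplex E)) (D : ObjectProperty E) :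
    ObjectProperty (Stable S) := fun X => D X.as

/-- `G D`: the full subcategory of `E` with the same objects as `D`. -/
def subOfStable (S : ObjectProperty (ShortComplex E)) (D : ObjectProperty (Stable S)) :
    ObjectProperty E := fun X => D ((toStable S).obj X)

end Exact

/-! ### Gorenstein projective objects -/

section Gorenstein

variable (A : Type u) [Category.{v} A] [Abelian A]

variable {A} in
/-- A complex `⋯ ⟶ P₁ ⟶ P₀ ⟶ P₋₁ ⟶ ⋯` of projective objects is totally acyclic if it is acyclic
and `Hom(P, Q)` is acyclic for all projective `Q`: each cocycle `Pₙ ⟶ Q` is a coboundary. -/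
structure IsTotallyAcyclic (P : ChainComplex A ℤ) : Prop where
  projective : ∀ n : ℤ, Projective (P.X n)
  acyclic : P.Acyclic
  hom_acyclic : ∀ (Q : A), Projective Q → ∀ (n : ℤ) (φ : P.X n ⟶ Q),
    P.d (n + 1) n ≫ φ = 0 → ∃ ψ : P.X (n - 1) ⟶ Q, P.d n (n - 1) ≫ ψ = φ

/-- The Gorenstein projective objects: the images of `P₀ ⟶ P₋₁` for the totally acyclic
complexes of projective objects. -/
def gproj : ObjectProperty A := fun X =>
  ∃ P : ChainComplex A ℤ, IsTotallyAcyclic P ∧ Nonempty (X ≅ image (P.d 0 (-1)))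

/-- The full subcategory of Gorenstein projective objects. -/
abbrev GprojCat : Type u := (gproj A).FullSubcategory

/-- The exact structure on the Gorenstein projective objects induced from the abelian category. -/
def gprojExact : ObjectProperty (ShortComplex (GprojCat A)) := fun T =>
  (T.map (gproj A).ι).ShortExact

variable {A} in
/-- The subcategory `D` of the Gorenstein projective objects contains all projective objects. -/
def ContainsProj (D : ObjectProperty (GprojCat A)) : Prop :=
  ∀ P : A, Projective P → ∃ hP : gproj A P, D ⟨P, hP⟩

end Gorenstein

end Gproj

/-!
The bijections hold for every Frobenius category `(E, S)`, with the complete (thick) subcategories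
that contain the `S`-injective objects. As `F` and `G` do not change the objects, only two
implications have to be shown.

If `D` is complete and contains the injectives, the sequence `X ⟶ I ⟶ TX` shows that `X` lies in `D`
if and only if `TX` does, and a standard triangle `X ⟶ Y ⟶ C ⟶ TX` comes with the short exact
sequence `Y ⟶ C ⟶ TX`; so `D` has the 2 out of 3 property for standard triangles. To pass to
isomorphic triangles, `D` has to be closed under stable isomorphism. This holds because the cone of a
stable isomorphism is injective (`IsFrobenius.IsStandardTriangle.relInjective`). A stable direct
summand of `X` is a direct summand of `X ⊞ J` in `E` for some injective `J`, which gives the thick case.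

Conversely, a triangulated subcategory is closed under isomorphism and contains the injectives,
because `X ⟶ Y ⟶ I ⟶ TX` is distinguished for each stable isomorphism `X ⟶ Y`. A short exact sequence
`X ⟶ Y ⟶ Z` gives a triangle, since the cone of an inflation is stably isomorphic to its cokernel
(`IsFrobenius.IsStandardTriangle.nonempty_iso`).

That the Gorenstein projective objects form a Frobenius category rests on their closure under
extensions. It is proved with a coinductive description that avoids complexes: they form the
largest class of objects `X` with `Ext¹(X, Q) = 0` for all projective `Q` in which each object has a
syzygy and is a syzygy (`IsSyzygyStable.gproj`, `isSyzygyStable_gproj`). By the horseshoe lemma,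
applied on both sides, the extensions of Gorenstein projective objects form such a class. The
relatively projective and the relatively injective objects are both the projective objects of the
abelian category.
-/

namespace Gproj

section Frobenius

/-! ### The stable category -/

variable {E : Type u} [Category.{v} E] [Preadditive E] {S : ObjectProperty (ShortComplex E)}

theorem RelInjective.of_id_eq_comp {C J : E} (hJ : RelInjective S J) (a : C ⟶ J) (b : J ⟶ C)
    (h : 𝟙 C = a ≫ b) : RelInjective S C := by
  intro X Y f k hf
  obtain ⟨l, hl⟩ := hJ f (k ≫ a) hf
  exact ⟨l ≫ b, by rw [← Category.assoc, hl, Category.assoc, ← h, Category.comp_id]⟩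

/-- Factoring through some injective object is the same as factoring through a given inflation
into an injective object. -/
theorem stableRel_iff_exists_eq_μ_comp {X Y : E} (c : Cosyzygy S X) (f g : X ⟶ Y) :
    stableRel S f g ↔ ∃ b : c.I ⟶ Y, f - g = c.μ ≫ b := by
  constructor
  · rintro ⟨J, a, b, hJ, hab⟩
    obtain ⟨a', ha'⟩ := hJ c.μ a ⟨_, _, _, c.mem⟩
    exact ⟨a' ≫ b, by rw [hab, ← ha', Category.assoc]⟩
  · rintro ⟨b, hb⟩
    exact ⟨c.I, c.μ, b, c.injective, hb⟩

theorem IsFrobenius.congruence_stableRel (hS : IsFrobenius S) : Congruence (stableRel S) where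
  equivalence {X Y} :=
    { refl := stableRel_refl hS
      symm := by
        rintro f g ⟨J, a, b, hJ, h⟩
        exact ⟨J, a, -b, hJ, by rw [Preadditive.comp_neg, ← h, neg_sub]⟩
      trans := by
        intro f g k h₁ h₂
        rw [stableRel_iff_exists_eq_μ_comp (hS.cosyzygy X)] at h₁ h₂ ⊢
        obtain ⟨b₁, h₁⟩ := h₁
        obtain ⟨b₂, h₂⟩ := h₂
        exact ⟨b₁ + b₂, by rw [Preadditive.comp_add, ← h₁, ← h₂, sub_add_sub_cancel]⟩ }
  comp_left := by
    rintro X Y Z f g g' ⟨J, a, b, hJ, h⟩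
    exact ⟨J, f ≫ a, b, hJ, by rw [← Preadditive.comp_sub, h, Category.assoc]⟩
  comp_right := by
    rintro X Y Z f f' g ⟨J, a, b, hJ, h⟩
    exact ⟨J, a, b ≫ g, hJ, by rw [← Preadditive.sub_comp, h, Category.assoc]⟩

theorem IsFrobenius.toStable_map_eq_iff (hS : IsFrobenius S) {X Y : E} (f g : X ⟶ Y) :
    (toStable S).map f = (toStable S).map g ↔ stableRel S f g :=
  haveI := hS.congruence_stableRel
  CategoryTheory.Quotient.functor_map_eq_iff _ f g

theorem IsFrobenius.toStable_map_eq_zero_iff (hS : IsFrobenius S) {X Y : E} (c : Cosyzygy S X)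
    (f : X ⟶ Y) : (toStable S).map f = (toStable S).map 0 ↔ ∃ b : c.I ⟶ Y, f = c.μ ≫ b := by
  rw [hS.toStable_map_eq_iff, stableRel_iff_exists_eq_μ_comp c, sub_zero]

/-- Any two injective objects are isomorphic in the stable category, being zero objects there. -/
theorem nonempty_iso_of_relInjective {I J : E} (hI : RelInjective S I) (hJ : RelInjective S J) :
    Nonempty ((toStable S).obj I ≅ (toStable S).obj J) :=
  ⟨{ hom := (toStable S).map 0
     inv := (toStable S).map 0
     hom_inv_id := by
       rw [← Functor.map_comp, ← CategoryTheory.Functor.map_id]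
       exact CategoryTheory.Quotient.sound _ ⟨I, 𝟙 I, -𝟙 I, hI, by simp⟩
     inv_hom_id := by
       rw [← Functor.map_comp, ← CategoryTheory.Functor.map_id]
       exact CategoryTheory.Quotient.sound _ ⟨J, 𝟙 J, -𝟙 J, hJ, by simp⟩ }⟩

/-! ### Standard triangles -/

theorem IsFrobenius.exists_isStandardTriangle (hS : IsFrobenius S) {X Y : E} (f : X ⟶ Y) :
    ∃ (C : E) (g : Y ⟶ C) (h : C ⟶ (hS.cosyzygy X).X'), hS.IsStandardTriangle f g h := by
  set c := hS.cosyzygy X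
  obtain ⟨C, f', g, hpo, Z, q, w, hq⟩ := hS.ex2_op c.μ f ⟨_, _, _, c.mem⟩
  obtain ⟨hcok⟩ := hS.cokernel _ hq
  have hh : c.μ ≫ c.π = f ≫ 0 := by rw [c.zero, comp_zero]
  -- Both `q` and `h` are cokernels of `g`, so that `Z` can be replaced by `TX`.
  let h : C ⟶ c.X' := hpo.desc c.π 0 hh
  have hf'h : f' ≫ h = c.π := hpo.inl_desc _ _ hh
  have hgh : g ≫ h = 0 := hpo.inr_desc _ _ hh
  obtain ⟨l, hl⟩ := CokernelCofork.IsColimit.desc' hcok h hgh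
  obtain ⟨m, hm⟩ := hS.exists_desc c (f' ≫ q) (by
    rw [← Category.assoc, hpo.w, Category.assoc, w, comp_zero])
  replace hl : q ≫ l = h := hl
  have hhm : h ≫ m = q := by
    apply hpo.hom_ext
    · rw [← Category.assoc, hf'h, hm]
    · rw [← Category.assoc, hgh, w, zero_comp]
  have hlm : l ≫ m = 𝟙 Z := Cofork.IsColimit.hom_ext hcok (by
    change q ≫ l ≫ m = q ≫ 𝟙 Z
    rw [← Category.assoc, hl, hhm, Category.comp_id])
  have hml : m ≫ l = 𝟙 c.X' := hS.π_cancel c (by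
    rw [← Category.assoc, hm, Category.assoc, hl, hf'h, Category.comp_id])
  refine ⟨C, g, h, f', hgh, hpo, hf'h, hS.of_iso _ _ ?_ hq⟩
  exact ShortComplex.isoMk (Iso.refl _) (Iso.refl _) ⟨l, m, hlm, hml⟩ (by simp) (by simp [hl])

theorem IsFrobenius.IsStandardTriangle.isDistinguished {hS : IsFrobenius S} {X Y C : E}
    {f : X ⟶ Y} {g : Y ⟶ C} {h : C ⟶ (hS.cosyzygy X).X'} (ht : hS.IsStandardTriangle f g h) :
    hS.IsDistinguished ((toStable S).map f) ((toStable S).map g)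
      (Z := (toStable S).obj C) ((toStable S).map h) :=
  ⟨X, Y, C, f, g, h, Iso.refl _, Iso.refl _, Iso.refl _, ht, by simp, by simp, by
    refine Eq.trans ?_ (Category.id_comp _).symm
    rw [Iso.refl_hom, CategoryTheory.Functor.map_id]
    exact Category.comp_id _⟩

/-- The cone of a stable isomorphism is zero: if `f` becomes invertible in the stable category,
then both `g` and `h` become zero there, and the identity of `C` factors through `g` up to
morphisms through injectives. -/
theorem IsFrobenius.IsStandardTriangle.relInjective {hS : IsFrobenius S} {X Y C : E}
    {f : X ⟶ Y} {g : Y ⟶ C} {h : C ⟶ (hS.cosyzygy X).X'} (ht : hS.IsStandardTriangle f g h)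
    [IsIso ((toStable S).map f)] : RelInjective S C := by
  obtain ⟨f', w, hpo, hf'h, hmem⟩ := ht
  have hfg : (toStable S).map (f ≫ g) = (toStable S).map 0 :=
    (hS.toStable_map_eq_zero_iff (hS.cosyzygy X) _).2 ⟨f', hpo.w.symm⟩
  have hg : (toStable S).map g = (toStable S).map 0 := by
    rw [← cancel_epi ((toStable S).map f), ← Functor.map_comp, ← Functor.map_comp, hfg, comp_zero]
  obtain ⟨F, hF, hF'⟩ := (hS.exists_isExtension (hS.cosyzygy X) (hS.cosyzygy Y) f).choose_spec
  set Tf := (hS.exists_isExtension (hS.cosyzygy X) (hS.cosyzygy Y) f).choose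
  -- `C ⟶ TX ⟶ TY` factors through the injective `I_Y`, by the universal property of `C`.
  have hTf : h ≫ Tf = hpo.desc F (hS.cosyzygy Y).μ hF ≫ (hS.cosyzygy Y).π := by
    apply hpo.hom_ext
    · rw [← Category.assoc, hf'h, hF', ← Category.assoc, hpo.inl_desc]
    · rw [← Category.assoc, w, zero_comp, ← Category.assoc, hpo.inr_desc, (hS.cosyzygy Y).zero]
  have hTf' : (toStable S).map Tf = hS.shift.map ((toStable S).map f) := rfl
  have : IsIso ((toStable S).map Tf) := by
    rw [hTf']
    exact Functor.map_isIso hS.shift ((toStable S).map f)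
  have hh : (toStable S).map h = (toStable S).map 0 := by
    rw [← cancel_mono ((toStable S).map Tf), ← Functor.map_comp, ← Functor.map_comp, zero_comp]
    exact CategoryTheory.Quotient.sound _
      ⟨_, hpo.desc F (hS.cosyzygy Y).μ hF, (hS.cosyzygy Y).π, (hS.cosyzygy Y).injective, by
        rw [hTf, sub_zero]⟩
  obtain ⟨b, hb⟩ := (hS.toStable_map_eq_zero_iff (hS.cosyzygy C) h).1 hh
  -- The injective `I_C` is projective, so `b` lifts along the deflation `I_X ⟶ TX`.
  obtain ⟨b', hb'⟩ := (hS.projective_iff_injective _).2 (hS.cosyzygy C).injective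
    (hS.cosyzygy X).π b ⟨_, _, _, (hS.cosyzygy X).mem⟩
  obtain ⟨hker⟩ := hS.kernel _ hmem
  obtain ⟨k, hk⟩ := KernelFork.IsLimit.lift' hker (𝟙 C - (hS.cosyzygy C).μ ≫ b' ≫ f') (by
    change (𝟙 C - (hS.cosyzygy C).μ ≫ b' ≫ f') ≫ h = 0
    rw [Preadditive.sub_comp, Category.id_comp, Category.assoc, Category.assoc, hf'h, hb', ← hb,
      sub_self])
  replace hk : k ≫ g = 𝟙 C - (hS.cosyzygy C).μ ≫ b' ≫ f' := hk
  have h0 : (toStable S).map (𝟙 C) = (toStable S).map 0 := by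
    have h1 : (toStable S).map (𝟙 C) = (toStable S).map (k ≫ g) :=
      CategoryTheory.Quotient.sound _
        ⟨_, (hS.cosyzygy C).μ, b' ≫ f', (hS.cosyzygy C).injective, by rw [hk, sub_sub_cancel]⟩
    rw [h1, Functor.map_comp, hg, ← Functor.map_comp, comp_zero]
  obtain ⟨e, he⟩ := (hS.toStable_map_eq_zero_iff (hS.cosyzygy C) (𝟙 C)).1 h0
  exact @RelInjective.of_id_eq_comp E _ _ S C _ (hS.cosyzygy C).injective _ _ he

/-- The cone of an inflation is its cokernel: the kernel `I` of `C ⟶ Z` is injective and splits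
off, so that `C ⟶ Z` becomes invertible in the stable category. -/
theorem IsFrobenius.IsStandardTriangle.nonempty_iso {hS : IsFrobenius S} {T : ShortComplex E}
    (hT : S T) {C : E} {g : T.X₂ ⟶ C} {h : C ⟶ (hS.cosyzygy T.X₁).X'}
    (ht : hS.IsStandardTriangle T.f g h) :
    Nonempty ((toStable S).obj C ≅ (toStable S).obj T.X₃) := by
  obtain ⟨f', w, hpo, hf'h, hmem⟩ := ht
  obtain ⟨hcok⟩ := hS.cokernel _ hT
  let c := hS.cosyzygy T.X₁
  obtain ⟨e, he⟩ := c.injective T.f c.μ ⟨_, _, _, hT⟩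
  have hr : c.μ ≫ 𝟙 c.I = T.f ≫ e := by rw [Category.comp_id, he]
  have hp : c.μ ≫ 0 = T.f ≫ T.g := by rw [comp_zero, T.zero]
  let r : C ⟶ c.I := hpo.desc (𝟙 _) e hr
  let p : C ⟶ T.X₃ := hpo.desc 0 T.g hp
  have hf'r : f' ≫ r = 𝟙 _ := hpo.inl_desc _ _ hr
  have hf'p : f' ≫ p = 0 := hpo.inl_desc _ _ hp
  have hgp : g ≫ p = T.g := hpo.inr_desc _ _ hp
  -- The idempotent `𝟙 C - r ≫ f'` vanishes on `I` and so factors through `p`.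
  obtain ⟨s, hs⟩ := CokernelCofork.IsColimit.desc' hcok (g ≫ (𝟙 C - r ≫ f')) (by
    rw [← Category.assoc, ← hpo.w, Category.assoc, Preadditive.comp_sub, ← Category.assoc f',
      hf'r, Category.comp_id, Category.id_comp, sub_self, comp_zero])
  change T.X₃ ⟶ C at s
  replace hs : T.g ≫ s = g ≫ (𝟙 C - r ≫ f') := hs
  have hps : p ≫ s = 𝟙 C - r ≫ f' := by
    apply hpo.hom_ext
    · rw [← Category.assoc, hf'p, zero_comp, Preadditive.comp_sub, ← Category.assoc f',
        hf'r, Category.comp_id, Category.id_comp, sub_self]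
    · rw [← Category.assoc, hgp, hs]
  have hsp : s ≫ p = 𝟙 _ := Cofork.IsColimit.hom_ext hcok (by
    change T.g ≫ s ≫ p = T.g ≫ 𝟙 _
    rw [← Category.assoc, hs, Category.assoc, Preadditive.sub_comp, Category.assoc, hf'p,
      comp_zero, sub_zero, Category.id_comp, Category.comp_id, hgp])
  refine ⟨(toStable S).map p, (toStable S).map s, ?_, ?_⟩
  · rw [← Functor.map_comp, ← CategoryTheory.Functor.map_id, hps]
    exact CategoryTheory.Quotient.sound _ ⟨c.I, r, -f', c.injective, by simp⟩
  · rw [← Functor.map_comp, hsp, CategoryTheory.Functor.map_id]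

/-! ### From subcategories of the exact category to the stable category -/

section

variable {D : ObjectProperty E} (hS : IsFrobenius S) (hD : IsComplete S D)
  (hI : ∀ J, RelInjective S J → D J)

include hS hD hI

theorem IsComplete.cosyzygy_iff (X : E) : D (hS.cosyzygy X).X' ↔ D X :=
  ⟨(hD.two_of_three _ (hS.cosyzygy X).mem).2.2 (hI _ (hS.cosyzygy X).injective),
    fun h => (hD.two_of_three _ (hS.cosyzygy X).mem).1 h (hI _ (hS.cosyzygy X).injective)⟩

/-- A complete subcategory that contains the injectives is closed under stable isomorphism: the
cone `C` of a stable isomorphism is injective, and `Y ⟶ C ⟶ TX` is a short exact sequence. -/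
theorem IsComplete.of_stable_iso {X Y : E} (e : (toStable S).obj X ≅ (toStable S).obj Y)
    (hX : D X) : D Y := by
  obtain ⟨f, hf⟩ := (toStable S).map_surjective e.hom
  have : IsIso ((toStable S).map f) := by rw [hf]; infer_instance
  obtain ⟨C, g, h, ht⟩ := hS.exists_isStandardTriangle f
  have hC : D C := hI _ ht.relInjective
  obtain ⟨-, w, -, -, hmem⟩ := ht
  exact (hD.two_of_three _ hmem).2.2 hC ((hD.cosyzygy_iff hS hI X).2 hX)

theorem IsComplete.isTriangulatedSub : IsTriangulatedSub hS (subToStable S D) where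
  nonempty := by
    obtain ⟨X, hX⟩ := hD.nonempty
    exact ⟨(toStable S).obj X, hX⟩
  two_of_three := by
    rintro X Y Z f g h ⟨X₀, Y₀, C₀, f₀, g₀, h₀, φ₁, φ₂, φ₃, ⟨-, w, -, -, hmem⟩, -⟩
    have key {W : Stable S} {W₀ : E} (φ : W ≅ (toStable S).obj W₀) : D W.as ↔ D W₀ :=
      ⟨hD.of_stable_iso hS hI (X := W.as) φ, hD.of_stable_iso hS hI (Y := W.as) φ.symm⟩
    change (D X.as → D Y.as → D Z.as) ∧ (D X.as → D Z.as → D Y.as) ∧ (D Y.as → D Z.as → D X.as)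
    rw [key φ₁, key φ₂, key φ₃, ← hD.cosyzygy_iff hS hI X₀]
    obtain ⟨h₁, h₂, h₃⟩ := hD.two_of_three _ hmem
    exact ⟨fun hX hY => h₂ hY hX, fun hX hZ => h₃ hZ hX, fun hY hZ => h₁ hY hZ⟩

end

/-- If `i ≫ p` is the identity of `Y` up to a morphism through the injective object `J`, then `Y`
is a direct summand of `X ⊞ J` in the exact category, and `X ⊞ J` is stably isomorphic to `X`. -/
theorem IsThick.isThickTriangulatedSub {D : ObjectProperty E} (hS : IsFrobenius S)
    (hD : IsThick S D) (hI : ∀ J, RelInjective S J → D J) :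
    IsThickTriangulatedSub hS (subToStable S D) where
  toIsTriangulatedSub := hD.toIsComplete.isTriangulatedSub hS hI
  summands := by
    rintro ⟨X⟩ ⟨Y⟩ i p hip hX
    obtain ⟨i, rfl⟩ := (toStable S).map_surjective (X := Y) (Y := X) i
    obtain ⟨p, rfl⟩ := (toStable S).map_surjective (X := X) (Y := Y) p
    have hip' : (toStable S).map (𝟙 Y) = (toStable S).map (i ≫ p) := by
      rw [CategoryTheory.Functor.map_id, CategoryTheory.Functor.map_comp]
      exact hip.symm
    obtain ⟨J, a, b, hJ, hab⟩ := (hS.toStable_map_eq_iff _ _).1 hip'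
    have := hS.hasFiniteBiproducts
    have := hasBinaryBiproducts_of_finite_biproducts E
    have e : (toStable S).obj X ≅ (toStable S).obj (X ⊞ J) :=
      { hom := (toStable S).map biprod.inl
        inv := (toStable S).map biprod.fst
        hom_inv_id := by
          rw [← Functor.map_comp, biprod.inl_fst, CategoryTheory.Functor.map_id]
        inv_hom_id := by
          rw [← Functor.map_comp, ← CategoryTheory.Functor.map_id]
          refine CategoryTheory.Quotient.sound _ ⟨J, biprod.snd, -biprod.inr, hJ, ?_⟩
          rw [← biprod.total, Preadditive.comp_neg, sub_add_cancel_left] }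
    refine hD.summands (biprod.lift i a) (biprod.desc p b) ?_
      (hD.toIsComplete.of_stable_iso hS hI e hX)
    rw [biprod.lift_desc, ← hab, add_sub_cancel]

/-! ### From subcategories of the stable category to the exact category -/

section

variable {hS : IsFrobenius S} {D : ObjectProperty (Stable S)}

/-- For a stable isomorphism from `X` to `Y`, the triangle `X ⟶ Y ⟶ I ⟶ TX` is distinguished, where
`X ⟶ I ⟶ TX` is the chosen sequence. -/
theorem IsFrobenius.isDistinguished_of_iso (hS : IsFrobenius S) {X : E} {Y : Stable S}
    (e : (toStable S).obj X ≅ Y) :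
    hS.IsDistinguished e.hom (e.inv ≫ (toStable S).map (hS.cosyzygy X).μ)
      ((toStable S).map (hS.cosyzygy X).π) := by
  have ht : hS.IsStandardTriangle (𝟙 X) (hS.cosyzygy X).μ (hS.cosyzygy X).π :=
    ⟨𝟙 _, (hS.cosyzygy X).zero, IsPushout.of_vert_isIso ⟨by simp⟩, Category.id_comp _,
      (hS.cosyzygy X).mem⟩
  refine ⟨_, _, _, _, _, _, Iso.refl _, e.symm, Iso.refl _, ht, by simp, by simp, ?_⟩
  refine Eq.trans ?_ (Category.id_comp _).symm
  rw [Iso.refl_hom, CategoryTheory.Functor.map_id]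
  exact Category.comp_id _

theorem IsTriangulatedSub.of_iso (hD : IsTriangulatedSub hS D) {X Y : Stable S} (e : X ≅ Y)
    (hX : D X) : D Y := by
  have hI := (hD.two_of_three _ _ _ (hS.isDistinguished_of_iso (X := X.as) (Iso.refl _))).1 hX hX
  exact (hD.two_of_three _ _ _ (hS.isDistinguished_of_iso (X := X.as) e)).2.1 hX hI

theorem IsTriangulatedSub.of_relInjective (hD : IsTriangulatedSub hS D) {J : E}
    (hJ : RelInjective S J) : D ((toStable S).obj J) := by
  obtain ⟨X, hX⟩ := hD.nonempty
  have hI := (hD.two_of_three _ _ _ (hS.isDistinguished_of_iso (X := X.as) (Iso.refl _))).1 hX hX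
  obtain ⟨e⟩ := nonempty_iso_of_relInjective (hS.cosyzygy X.as).injective hJ
  exact hD.of_iso e hI

theorem IsTriangulatedSub.isComplete (hD : IsTriangulatedSub hS D) :
    IsComplete S (subOfStable S D) where
  nonempty := by
    obtain ⟨X, hX⟩ := hD.nonempty
    exact ⟨X.as, hX⟩
  two_of_three := by
    intro T hT
    obtain ⟨C, g, h, ht⟩ := hS.exists_isStandardTriangle T.f
    obtain ⟨e⟩ := ht.nonempty_iso hT
    have hC : D ((toStable S).obj C) ↔ D ((toStable S).obj T.X₃) :=
      ⟨hD.of_iso e, hD.of_iso e.symm⟩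
    have := hD.two_of_three _ _ _ ht.isDistinguished
    rwa [hC] at this

theorem IsThickTriangulatedSub.isThick (hD : IsThickTriangulatedSub hS D) :
    IsThick S (subOfStable S D) where
  toIsComplete := hD.toIsTriangulatedSub.isComplete
  summands := by
    intro X Y i p hip hX
    refine hD.summands ((toStable S).map i) ((toStable S).map p) ?_ hX
    rw [← Functor.map_comp, hip, CategoryTheory.Functor.map_id]

end

theorem invOn_subOfStable_subToStable (s : Set (ObjectProperty E))
    (t : Set (ObjectProperty (Stable S))) :
    Set.InvOn (subOfStable S) (subToStable S) s t :=
  ⟨fun _ _ => rfl, fun _ _ => rfl⟩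

end Frobenius

section ShortExact

variable {A : Type u} [Category.{v} A] [Abelian A]

/-! ### Short exact sequences of kernels and cokernels -/

/-- The connecting morphism of the snake vanishes, because the cokernel of `s.v₁₂.τ₁` is zero. -/
theorem shortExact_snakeInput_L₀ (s : ShortComplex.SnakeInput A) [Mono s.L₁.f] [Epi s.v₁₂.τ₁] :
    s.L₀.ShortExact := by
  have hτ : s.v₂₃.τ₁ = 0 := by rw [← cancel_epi s.v₁₂.τ₁, s.w₁₃_τ₁, comp_zero]
  have hδ : s.δ = 0 := by
    refine IsZero.eq_of_tgt ?_ _ _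
    rw [IsZero.iff_id_eq_zero, ← cancel_epi s.v₂₃.τ₁, hτ, zero_comp, zero_comp]
  have hf : Mono (s.L₀.f ≫ s.v₀₁.τ₂) := by
    rw [← s.v₀₁.comm₁₂]
    infer_instance
  exact .mk' s.L₀_exact (mono_of_mono _ s.v₀₁.τ₂) ((s.L₁'.exact_iff_epi hδ).1 s.L₁'_exact)

/-- If the outer two components of a morphism of short exact sequences are epimorphisms, then
the kernels form a short exact sequence. -/
theorem exists_shortExact_kernel {T₁ T₂ : ShortComplex A} (h₁ : T₁.ShortExact)
    (h₂ : T₂.ShortExact) (φ : T₁ ⟶ T₂) (e₁ : Epi φ.τ₁) (e₃ : Epi φ.τ₃) :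
    ∃ (T₀ : ShortComplex A) (ι : T₀ ⟶ T₁) (w₁ : ι.τ₁ ≫ φ.τ₁ = 0) (w₂ : ι.τ₂ ≫ φ.τ₂ = 0)
      (w₃ : ι.τ₃ ≫ φ.τ₃ = 0), T₀.ShortExact ∧ (ShortComplex.mk _ _ w₁).ShortExact ∧
        (ShortComplex.mk _ _ w₂).ShortExact ∧ (ShortComplex.mk _ _ w₃).ShortExact := by
  have := h₁.epi_g
  have := h₂.epi_g
  have e₂ : Epi φ.τ₂ := ShortComplex.epi_τ₂_of_exact_of_epi φ h₂.exact
  let s : ShortComplex.SnakeInput A :=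
    { L₀ := kernel φ
      L₁ := T₁
      L₂ := T₂
      L₃ := cokernel φ
      v₀₁ := kernel.ι φ
      v₁₂ := φ
      v₂₃ := cokernel.π φ
      w₀₂ := kernel.condition φ
      w₁₃ := cokernel.condition φ
      h₀ := kernelIsKernel φ
      h₃ := cokernelIsCokernel φ
      L₁_exact := h₁.exact
      epi_L₁_g := h₁.epi_g
      L₂_exact := h₂.exact
      mono_L₂_f := h₂.mono_f }
  have : Mono s.L₁.f := h₁.mono_f
  have : Epi s.v₁₂.τ₁ := e₁
  exact ⟨s.L₀, s.v₀₁, s.w₀₂_τ₁, s.w₀₂_τ₂, s.w₀₂_τ₃, shortExact_snakeInput_L₀ s,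
    .mk' s.exact_C₁_up s.mono_v₀₁_τ₁ e₁, .mk' s.exact_C₂_up s.mono_v₀₁_τ₂ e₂,
    .mk' s.exact_C₃_up s.mono_v₀₁_τ₃ e₃⟩

theorem exists_shortExact_cokernel {T₁ T₂ : ShortComplex A} (h₁ : T₁.ShortExact)
    (h₂ : T₂.ShortExact) (φ : T₁ ⟶ T₂) (m₁ : Mono φ.τ₁) (m₃ : Mono φ.τ₃) :
    ∃ (T₃ : ShortComplex A) (π : T₂ ⟶ T₃) (w₁ : φ.τ₁ ≫ π.τ₁ = 0) (w₂ : φ.τ₂ ≫ π.τ₂ = 0)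
      (w₃ : φ.τ₃ ≫ π.τ₃ = 0), T₃.ShortExact ∧ (ShortComplex.mk _ _ w₁).ShortExact ∧
        (ShortComplex.mk _ _ w₂).ShortExact ∧ (ShortComplex.mk _ _ w₃).ShortExact := by
  have := m₁
  have := m₃
  obtain ⟨T₀, ι, w₁, w₂, w₃, h, k₁, k₂, k₃⟩ := exists_shortExact_kernel h₂.op h₁.op
    (ShortComplex.opMap φ) (inferInstanceAs (Epi φ.τ₃.op)) (inferInstanceAs (Epi φ.τ₁.op))
  exact ⟨T₀.unop, ShortComplex.unopMap ι, congrArg Quiver.Hom.unop w₃,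
    congrArg Quiver.Hom.unop w₂, congrArg Quiver.Hom.unop w₁, h.unop, k₃.unop, k₂.unop, k₁.unop⟩

/-- The pullback of a short exact sequence. -/
theorem shortExact_of_isPullback {T : ShortComplex A} (hT : T.ShortExact) {P C : A}
    {h' : P ⟶ T.X₂} {g' : P ⟶ C} {h : C ⟶ T.X₃} (hp : IsPullback h' g' T.g h) :
    ∃ (k : T.X₁ ⟶ P) (w : k ≫ g' = 0), (ShortComplex.mk k g' w).ShortExact := by
  have := hT.mono_f
  have := hT.epi_g
  have hk : T.f ≫ T.g = 0 ≫ h := by rw [T.zero, zero_comp]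
  have hkh : hp.lift T.f 0 hk ≫ h' = T.f := hp.lift_fst _ _ hk
  have hkg : hp.lift T.f 0 hk ≫ g' = 0 := hp.lift_snd _ _ hk
  have hm : Mono (hp.lift T.f 0 hk) := by
    have : Mono (hp.lift T.f 0 hk ≫ h') := by rw [hkh]; infer_instance
    exact mono_of_mono _ h'
  refine ⟨hp.lift T.f 0 hk, hkg, .mk' (ShortComplex.exact_of_f_is_kernel _ ?_) hm ?_⟩
  · refine KernelFork.IsLimit.ofι' _ _ fun {W} k hk₀ => ⟨hT.exact.lift (k ≫ h') ?_, ?_⟩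
    · rw [Category.assoc, hp.w, ← Category.assoc, hk₀, zero_comp]
    · apply hp.hom_ext
      · rw [Category.assoc, hkh, hT.exact.lift_f]
      · rw [Category.assoc, hkg, comp_zero, hk₀]
  · exact Abelian.epi_snd_of_isLimit _ _ hp.isLimit

theorem shortExact_of_isPushout {T : ShortComplex A} (hT : T.ShortExact) {P C : A}
    {h' : T.X₂ ⟶ P} {f' : C ⟶ P} {h : T.X₁ ⟶ C} (hp : IsPushout T.f h h' f') :
    ∃ (k : P ⟶ T.X₃) (w : f' ≫ k = 0), (ShortComplex.mk f' k w).ShortExact := by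
  obtain ⟨k, w, hk⟩ := shortExact_of_isPullback hT.op hp.op.flip
  exact ⟨k.unop, congrArg Quiver.Hom.unop w, hk.unop⟩

/-- Two short exact sequences with the same epimorphism have isomorphic first terms. -/
theorem nonempty_iso_of_shortExact {K K' X Y : A} {i : K ⟶ X} {i' : K' ⟶ X} {p : X ⟶ Y}
    {w : i ≫ p = 0} {w' : i' ≫ p = 0} (h : (ShortComplex.mk i p w).ShortExact)
    (h' : (ShortComplex.mk i' p w').ShortExact) : Nonempty (K ≅ K') :=
  ⟨IsLimit.conePointUniqueUpToIso h.fIsKernel h'.fIsKernel⟩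

theorem nonempty_iso_of_shortExact' {K X Y Y' : A} {i : K ⟶ X} {p : X ⟶ Y} {p' : X ⟶ Y'}
    {w : i ≫ p = 0} {w' : i ≫ p' = 0} (h : (ShortComplex.mk i p w).ShortExact)
    (h' : (ShortComplex.mk i p' w').ShortExact) : Nonempty (Y ≅ Y') :=
  ⟨IsColimit.coconePointUniqueUpToIso h.gIsCokernel h'.gIsCokernel⟩

/-- The kernels of `f`, `f ≫ g` and `g`, for epimorphisms `f` and `g`. -/
theorem exists_shortExact_kernel_comp {K L X Y Z : A} {i : K ⟶ X} {f : X ⟶ Y} {j : L ⟶ Y}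
    {g : Y ⟶ Z} {w : i ≫ f = 0} {w' : j ≫ g = 0} (hf : (ShortComplex.mk i f w).ShortExact)
    (hg : (ShortComplex.mk j g w').ShortExact) :
    ∃ (M : A) (k : M ⟶ X) (wk : k ≫ f ≫ g = 0) (a : K ⟶ M) (b : M ⟶ L) (wab : a ≫ b = 0),
      (ShortComplex.mk k (f ≫ g) wk).ShortExact ∧ (ShortComplex.mk a b wab).ShortExact := by
  have : Epi f := hf.epi_g
  have : Epi g := hg.epi_g
  have : Mono j := hg.mono_f
  obtain ⟨a, wa, ha⟩ := shortExact_of_isPullback hf (IsPullback.of_hasPullback f j)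
  have hk : pullback.fst f j ≫ f ≫ g = 0 := by
    rw [pullback.condition_assoc, w', comp_zero]
  refine ⟨_, pullback.fst f j, hk, a, _, wa,
    .mk' (ShortComplex.exact_of_f_is_kernel _ ?_) inferInstance inferInstance, ha⟩
  refine KernelFork.IsLimit.ofι' _ _ fun {W} t ht =>
    ⟨pullback.lift t (hg.exact.lift (t ≫ f) (by simpa using ht)) ?_, pullback.lift_fst _ _ _⟩
  exact (hg.exact.lift_f _ _).symm

end ShortExact

section Syzygy

universe w

variable {A : Type u} [Category.{v} A] [Abelian A]

/-! ### Orthogonality to the projective objects -/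

section Ext

variable [HasExt.{w} A]

variable (A) in
/-- The objects `X` with `Ext¹(X, Q) = 0` for all projective `Q`. -/
def extOrthogonal : ObjectProperty A := fun X =>
  ∀ (Q : A), Projective Q → ∀ x : Abelian.Ext X Q 1, x = 0

theorem extOrthogonal.exists_extension {T : ShortComplex A} (hT : T.ShortExact)
    (h : extOrthogonal A T.X₃) {Q : A} (hQ : Projective Q) (a : T.X₁ ⟶ Q) :
    ∃ b : T.X₂ ⟶ Q, T.f ≫ b = a := by
  obtain ⟨x, hx⟩ := Abelian.Ext.contravariant_sequence_exact₁ hT Q (Abelian.Ext.mk₀ a)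
    (add_zero 1) (h Q hQ _)
  obtain ⟨b, rfl⟩ := (Abelian.Ext.mk₀_bijective _ _).2 x
  rw [Abelian.Ext.mk₀_comp_mk₀] at hx
  exact ⟨b, (Abelian.Ext.mk₀_bijective _ _).1 hx⟩

theorem extOrthogonal_of_exists_extension {T : ShortComplex A} (hT : T.ShortExact)
    (hP : Projective T.X₂)
    (h : ∀ (Q : A), Projective Q → ∀ a : T.X₁ ⟶ Q, ∃ b : T.X₂ ⟶ Q, T.f ≫ b = a) :
    extOrthogonal A T.X₃ := by
  intro Q hQ x
  obtain ⟨y, rfl⟩ := Abelian.Ext.contravariant_sequence_exact₃ hT Q x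
    (Abelian.Ext.eq_zero_of_projective _) (add_zero 1)
  obtain ⟨a, rfl⟩ := (Abelian.Ext.mk₀_bijective _ _).2 y
  obtain ⟨b, rfl⟩ := h Q hQ a
  rw [← Abelian.Ext.mk₀_comp_mk₀, hT.extClass_comp_assoc]

theorem extOrthogonal_of_shortExact {T : ShortComplex A} (hT : T.ShortExact)
    (h₁ : extOrthogonal A T.X₁) (h₃ : extOrthogonal A T.X₃) : extOrthogonal A T.X₂ := by
  intro Q hQ x
  obtain ⟨y, rfl⟩ := Abelian.Ext.contravariant_sequence_exact₂ hT Q x (h₁ Q hQ _)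
  rw [h₃ Q hQ y, Abelian.Ext.comp_zero]

theorem extOrthogonal_of_projective {P : A} (hP : Projective P) : extOrthogonal A P :=
  fun _ _ _ => Abelian.Ext.eq_zero_of_projective _

theorem extOrthogonal_of_iso {X Y : A} (e : X ≅ Y) (hX : extOrthogonal A X) :
    extOrthogonal A Y := by
  intro Q hQ x
  have h := hX Q hQ ((Abelian.Ext.mk₀ e.hom).comp x (zero_add 1))
  have : (Abelian.Ext.mk₀ e.inv).comp ((Abelian.Ext.mk₀ e.hom).comp x (zero_add 1))
      (zero_add 1) = x := by
    rw [Abelian.Ext.mk₀_comp_mk₀_assoc, e.inv_hom_id, Abelian.Ext.mk₀_id_comp]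
  rw [← this, h, Abelian.Ext.comp_zero]

end Ext

/-! ### Syzygies -/

/-- `X'` is a first syzygy of `X`: there is a short exact sequence `X' ⟶ P ⟶ X` with `P`
projective. -/
def IsSyzygy (X' X : A) : Prop :=
  ∃ (P : A) (i : X' ⟶ P) (p : P ⟶ X) (w : i ≫ p = 0), Projective P ∧
    (ShortComplex.mk i p w).ShortExact

theorem IsSyzygy.of_iso_right {X' X Y : A} (h : IsSyzygy X' X) (e : X ≅ Y) : IsSyzygy X' Y := by
  obtain ⟨P, i, p, w, hP, hs⟩ := h
  refine ⟨P, i, p ≫ e.hom, by rw [← Category.assoc, w, zero_comp], hP, ?_⟩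
  exact ShortComplex.shortExact_of_iso (S₁ := ShortComplex.mk i p w)
    (ShortComplex.isoMk (Iso.refl _) (Iso.refl _) e (by simp) (by simp)) hs

theorem IsSyzygy.of_iso_left {X' Y X : A} (h : IsSyzygy X' X) (e : X' ≅ Y) : IsSyzygy Y X := by
  obtain ⟨P, i, p, w, hP, hs⟩ := h
  refine ⟨P, e.inv ≫ i, p, by rw [Category.assoc, w, comp_zero], hP, ?_⟩
  exact ShortComplex.shortExact_of_iso (S₁ := ShortComplex.mk i p w)
    (ShortComplex.isoMk e (Iso.refl _) (Iso.refl _) (by simp) (by simp)) hs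

/-- The horseshoe lemma for syzygies. -/
theorem exists_isSyzygy_of_shortExact {T : ShortComplex A} (hT : T.ShortExact) {X' Z' : A}
    (hX : IsSyzygy X' T.X₁) (hZ : IsSyzygy Z' T.X₃) :
    ∃ T' : ShortComplex A, T'.ShortExact ∧ Nonempty (X' ≅ T'.X₁) ∧ Nonempty (Z' ≅ T'.X₃) ∧
      IsSyzygy T'.X₂ T.X₂ := by
  obtain ⟨P, i, p, w, hP, hp⟩ := hX
  obtain ⟨R, j, r, w', hR, hr⟩ := hZ
  have := hT.epi_g
  let φ : ShortComplex.mk (biprod.inl : P ⟶ P ⊞ R) biprod.snd biprod.inl_snd ⟶ T :=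
    { τ₁ := p
      τ₂ := biprod.desc (p ≫ T.f) (Projective.factorThru r T.g)
      τ₃ := r
      comm₁₂ := by simp
      comm₂₃ := by ext <;> simp }
  obtain ⟨T', ι, w₁, w₂, w₃, h, k₁, k₂, k₃⟩ := exists_shortExact_kernel
    (ShortComplex.Splitting.ofHasBinaryBiproduct P R).shortExact hT φ hp.epi_g hr.epi_g
  exact ⟨T', h, nonempty_iso_of_shortExact hp k₁, nonempty_iso_of_shortExact hr k₃,
    P ⊞ R, ι.τ₂, φ.τ₂, w₂, inferInstance, k₂⟩

/-- The horseshoe lemma for cosyzygies. The morphism from `T.X₁` to a projective object has to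
be extended to `T.X₂`, which is where the orthogonality of `T.X₃` is used. -/
theorem exists_isSyzygy_of_shortExact' [HasExt.{w} A] {T : ShortComplex A} (hT : T.ShortExact)
    (h₃ : extOrthogonal A T.X₃) {X' Z' : A} (hX : IsSyzygy T.X₁ X') (hZ : IsSyzygy T.X₃ Z') :
    ∃ T' : ShortComplex A, T'.ShortExact ∧ Nonempty (X' ≅ T'.X₁) ∧ Nonempty (Z' ≅ T'.X₃) ∧
      IsSyzygy T.X₂ T'.X₂ := by
  obtain ⟨P, i, p, w, hP, hp⟩ := hX
  obtain ⟨R, j, r, w', hR, hr⟩ := hZ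
  obtain ⟨e, he⟩ := h₃.exists_extension hT hP i
  let φ : T ⟶ ShortComplex.mk (biprod.inl : P ⟶ P ⊞ R) biprod.snd biprod.inl_snd :=
    { τ₁ := i
      τ₂ := biprod.lift e (T.g ≫ j)
      τ₃ := j
      comm₁₂ := by ext <;> simp [he]
      comm₂₃ := by simp }
  obtain ⟨T', π, w₁, w₂, w₃, h, k₁, k₂, k₃⟩ := exists_shortExact_cokernel hT
    (ShortComplex.Splitting.ofHasBinaryBiproduct P R).shortExact φ hp.mono_f hr.mono_f
  exact ⟨T', h, nonempty_iso_of_shortExact' hp k₁, nonempty_iso_of_shortExact' hr k₃,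
    P ⊞ R, φ.τ₂, π.τ₂, w₂, inferInstance, k₂⟩

/-- Exactness in the middle does not change when the first morphism is precomposed with an
epimorphism and the second one is postcomposed with a monomorphism. -/
theorem exact_iff_of_epi_comp_of_comp_mono {W X Y Z V : A} {e : W ⟶ X} [Epi e] {f : X ⟶ Y}
    {g : Y ⟶ Z} {m : Z ⟶ V} [Mono m] {f' : W ⟶ Y} {g' : Y ⟶ V} (hf : f' = e ≫ f)
    (hg : g' = g ≫ m) (w : f ≫ g = 0) (w' : f' ≫ g' = 0) :
    (ShortComplex.mk f' g' w').Exact ↔ (ShortComplex.mk f g w).Exact := by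
  subst hf hg
  have h : (e ≫ f) ≫ g = 0 := by rw [Category.assoc, w, comp_zero]
  have h₁ := ShortComplex.exact_iff_of_epi_of_isIso_of_mono (S₁ := ShortComplex.mk _ _ h)
    (S₂ := ShortComplex.mk _ _ w') { τ₁ := 𝟙 _, τ₂ := 𝟙 _, τ₃ := m }
  have h₂ := ShortComplex.exact_iff_of_epi_of_isIso_of_mono (S₁ := ShortComplex.mk _ _ h)
    (S₂ := ShortComplex.mk _ _ w) { τ₁ := e, τ₂ := 𝟙 _, τ₃ := 𝟙 _ }
  exact h₁.symm.trans h₂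

/-! ### A coinductive description of the Gorenstein projective objects -/

/-- A class of objects orthogonal to the projective objects in which each object has a syzygy and
is a syzygy. The Gorenstein projective objects form the largest such class. -/
structure IsSyzygyStable [HasExt.{w} A] (W : ObjectProperty A) : Prop where
  ext : ∀ X, W X → extOrthogonal A X
  exists_syzygy : ∀ X, W X → ∃ X', W X' ∧ IsSyzygy X' X
  exists_cosyzygy : ∀ X, W X → ∃ X', W X' ∧ IsSyzygy X X'

/-- In a syzygy-stable class, syzygies can be iterated in both directions. -/
theorem IsSyzygyStable.exists_int_family [HasExt.{w} A] {W : ObjectProperty A}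
    (hW : IsSyzygyStable W) {X : A} (hX : W X) :
    ∃ K : ℤ → A, K 0 = X ∧ (∀ n, W (K n)) ∧ ∀ n, IsSyzygy (K (n + 1)) (K n) := by
  choose l hl using fun Y : Subtype W => hW.exists_syzygy Y.1 Y.2
  choose r hr using fun Y : Subtype W => hW.exists_cosyzygy Y.1 Y.2
  let L (Y : Subtype W) : Subtype W := ⟨l Y, (hl Y).1⟩
  let R (Y : Subtype W) : Subtype W := ⟨r Y, (hr Y).1⟩
  let K : ℤ → Subtype W
    | Int.ofNat n => L^[n] ⟨X, hX⟩
    | Int.negSucc n => R^[n + 1] ⟨X, hX⟩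
  refine ⟨fun n => (K n).1, rfl, fun n => (K n).2, ?_⟩
  rintro (n | n | n)
  · change IsSyzygy (L^[n + 1] ⟨X, hX⟩).1 (L^[n] ⟨X, hX⟩).1
    rw [Function.iterate_succ_apply']
    exact (hl _).2
  · exact (hr _).2
  · change IsSyzygy (R^[n + 1] ⟨X, hX⟩).1 (R^[n + 2] ⟨X, hX⟩).1
    rw [Function.iterate_succ_apply' R (n + 1)]
    exact (hr _).2

/-- The short exact sequences `K (n + 1) ⟶ Q n ⟶ K n` are spliced to a complex `Q`. -/
theorem IsSyzygyStable.gproj [HasExt.{w} A] {W : ObjectProperty A} (hW : IsSyzygyStable W) {X : A}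
    (hX : W X) : gproj A X := by
  obtain ⟨K, rfl, hK, hs⟩ := hW.exists_int_family hX
  choose Q i p w hQ hip using hs
  have hi (n) : Mono (i n) := (hip n).mono_f
  have hp (n) : Epi (p n) := (hip n).epi_g
  let P : ChainComplex A ℤ := ChainComplex.of Q (fun n => p (n + 1) ≫ i n) (fun n => by
    rw [Category.assoc, reassoc_of% w (n + 1), zero_comp, comp_zero])
  have hd (n : ℤ) : P.d (n + 1) n = p (n + 1) ≫ i n :=
    ChainComplex.of_d Q (fun n => p (n + 1) ≫ i n) n
  have himage (m n : ℤ) (hm : m = n + 1) : Nonempty (K m ≅ image (P.d m n)) := by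
    subst hm
    have : StrongEpi (p (n + 1)) := strongEpi_of_epi _
    exact ⟨image.isoStrongEpiMono (p (n + 1)) (i n) (hd n).symm⟩
  refine ⟨P, ⟨hQ, ?_, ?_⟩, himage 0 (-1) (by norm_num)⟩
  · intro n
    obtain ⟨n, rfl⟩ : ∃ m, n = m + 1 := ⟨n - 1, by omega⟩
    rw [P.exactAt_iff' (n + 1 + 1) (n + 1) n (by simp) (by simp)]
    exact (exact_iff_of_epi_comp_of_comp_mono (hd (n + 1)) (hd n) (w (n + 1)) _).2
      (hip (n + 1)).exact
  -- A cocycle descends to `K (n + 1)` and extends to `Q n`, as `K n` is orthogonal to projectives.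
  · have key (R : A) (hR : Projective R) (n : ℤ) (φ : P.X (n + 1) ⟶ R)
        (hφ : P.d (n + 1 + 1) (n + 1) ≫ φ = 0) :
        ∃ ψ : P.X n ⟶ R, P.d (n + 1) n ≫ ψ = φ := by
      rw [hd, Category.assoc] at hφ
      have h₁ : i (n + 1) ≫ φ = 0 := by rw [← cancel_epi (p (n + 1 + 1)), hφ, comp_zero]
      obtain ⟨ψ, hψ⟩ := (hW.ext _ (hK n)).exists_extension (hip n) hR
        ((hip (n + 1)).exact.desc φ h₁)
      refine ⟨ψ, ?_⟩
      rw [hd, Category.assoc]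
      exact (congrArg (p (n + 1) ≫ ·) hψ).trans ((hip (n + 1)).exact.g_desc φ h₁)
    intro R hR n φ hφ
    obtain ⟨n, rfl⟩ : ∃ m, n = m + 1 := ⟨n - 1, by omega⟩
    rw [add_sub_cancel_right]
    exact key R hR n φ hφ

/-- In a totally acyclic complex, the image of `P (n + 2) ⟶ P (n + 1)` is a syzygy of the image of
`P (n + 1) ⟶ P n`. -/
theorem IsTotallyAcyclic.shortExact_image {P : ChainComplex A ℤ} (hP : IsTotallyAcyclic P)
    (n : ℤ) : ∃ w : image.ι (P.d (n + 1 + 1) (n + 1)) ≫ factorThruImage (P.d (n + 1) n) = 0,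
      (ShortComplex.mk _ _ w).ShortExact := by
  have w : image.ι (P.d (n + 1 + 1) (n + 1)) ≫ factorThruImage (P.d (n + 1) n) = 0 := by
    rw [← cancel_mono (image.ι (P.d (n + 1) n)),
      ← cancel_epi (factorThruImage (P.d (n + 1 + 1) (n + 1)))]
    simp
  refine ⟨w, .mk' ?_ inferInstance inferInstance⟩
  have h := hP.acyclic (n + 1)
  rw [P.exactAt_iff' (n + 1 + 1) (n + 1) n (by simp) (by simp)] at h
  exact (exact_iff_of_epi_comp_of_comp_mono (image.fac _).symm (image.fac _).symm w _).1 h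

/-- The images of all differentials of totally acyclic complexes form a syzygy-stable class. -/
theorem isSyzygyStable_image [HasExt.{w} A] : IsSyzygyStable (fun X : A =>
    ∃ P : ChainComplex A ℤ, IsTotallyAcyclic P ∧ ∃ m n : ℤ, m = n + 1 ∧
      Nonempty (X ≅ image (P.d m n))) where
  ext := by
    rintro X ⟨P, hP, _, n, rfl, ⟨e⟩⟩
    obtain ⟨w, hs⟩ := hP.shortExact_image n
    refine extOrthogonal_of_iso e.symm
      (extOrthogonal_of_exists_extension hs (hP.projective (n + 1)) fun Q hQ a => ?_)
    have key (m k : ℤ) (hm : n + 1 = m) (hk : n + 1 + 1 = k) (φ : P.X k ⟶ Q)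
        (hφ : P.d (k + 1) k ≫ φ = 0) : ∃ ψ : P.X m ⟶ Q, P.d k m ≫ ψ = φ := by
      obtain rfl : m = k - 1 := by omega
      exact hP.hom_acyclic Q hQ k φ hφ
    obtain ⟨ψ, hψ⟩ := key (n + 1) (n + 1 + 1) rfl rfl
      (factorThruImage (P.d (n + 1 + 1) (n + 1)) ≫ a) (by
        have : P.d (n + 1 + 1 + 1) (n + 1 + 1) ≫ factorThruImage (P.d (n + 1 + 1) (n + 1)) = 0 := by
          rw [← cancel_mono (image.ι (P.d (n + 1 + 1) (n + 1)))]
          simp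
        rw [← Category.assoc, this, zero_comp])
    refine ⟨ψ, ?_⟩
    change image.ι (P.d (n + 1 + 1) (n + 1)) ≫ ψ = a
    rw [← cancel_epi (factorThruImage (P.d (n + 1 + 1) (n + 1))), ← Category.assoc, image.fac, hψ]
  exists_syzygy := by
    rintro X ⟨P, hP, _, n, rfl, ⟨e⟩⟩
    obtain ⟨w, hs⟩ := hP.shortExact_image n
    exact ⟨_, ⟨P, hP, _, n + 1, rfl, ⟨Iso.refl _⟩⟩,
      IsSyzygy.of_iso_right ⟨_, _, _, w, hP.projective _, hs⟩ e.symm⟩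
  exists_cosyzygy := by
    rintro X ⟨P, hP, _, n, rfl, ⟨e⟩⟩
    obtain ⟨n, rfl⟩ : ∃ m, n = m + 1 := ⟨n - 1, by omega⟩
    obtain ⟨w, hs⟩ := hP.shortExact_image n
    exact ⟨_, ⟨P, hP, _, n, rfl, ⟨Iso.refl _⟩⟩,
      IsSyzygy.of_iso_left ⟨_, _, _, w, hP.projective _, hs⟩ e.symm⟩

theorem isSyzygyStable_gproj [HasExt.{w} A] : IsSyzygyStable (gproj A) := by
  have h : gproj A = fun X : A => ∃ P : ChainComplex A ℤ, IsTotallyAcyclic P ∧ ∃ m n : ℤ, m = n + 1 ∧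
      Nonempty (X ≅ image (P.d m n)) := by
    ext X
    refine ⟨fun ⟨P, hP, e⟩ => ⟨P, hP, 0, -1, by norm_num, e⟩, fun hX => isSyzygyStable_image.gproj hX⟩
  rw [h]
  exact isSyzygyStable_image

/-! ### Closure properties of the Gorenstein projective objects -/

instance : (gproj A).IsClosedUnderIsomorphisms where
  of_iso := by
    rintro X Y e ⟨P, hP, ⟨e'⟩⟩
    exact ⟨P, hP, ⟨e.symm ≪≫ e'⟩⟩

open scoped ZeroObject in
theorem gproj_of_projective {P : A} (hP : Projective P) : gproj A P := by
  have := HasExt.standard A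
  have h : IsSyzygyStable (fun P : A => Projective P) :=
    { ext := fun _ hX => extOrthogonal_of_projective hX
      exists_syzygy := fun X hX => ⟨0, inferInstance, X, 0, 𝟙 X, by simp, hX,
        .mk' ((ShortComplex.exact_iff_mono _ rfl).2 inferInstance) inferInstance inferInstance⟩
      exists_cosyzygy := fun X hX => ⟨0, inferInstance, X, 𝟙 X, 0, by simp, hX,
        .mk' ((ShortComplex.exact_iff_epi _ rfl).2 inferInstance) inferInstance inferInstance⟩ }
  exact h.gproj hP

open scoped ZeroObject in
instance : (gproj A).ContainsZero where
  exists_zero := ⟨0, isZero_zero A, gproj_of_projective inferInstance⟩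

/-- By the horseshoe lemma, the extensions of Gorenstein projective objects form a
syzygy-stable class. -/
instance : (gproj A).IsClosedUnderExtensions where
  prop_X₂_of_shortExact {T} hT h₁ h₃ := by
    have := HasExt.standard A
    have hG := isSyzygyStable_gproj (A := A)
    have h : IsSyzygyStable (fun Y : A => ∃ T : ShortComplex A, T.ShortExact ∧ gproj A T.X₁ ∧
        gproj A T.X₃ ∧ T.X₂ = Y) :=
      { ext := by
          rintro _ ⟨T, hT, h₁, h₃, rfl⟩
          exact extOrthogonal_of_shortExact hT (hG.ext _ h₁) (hG.ext _ h₃)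
        exists_syzygy := by
          rintro _ ⟨T, hT, h₁, h₃, rfl⟩
          obtain ⟨X', hX', hX⟩ := hG.exists_syzygy _ h₁
          obtain ⟨Z', hZ', hZ⟩ := hG.exists_syzygy _ h₃
          obtain ⟨T', hT', ⟨e₁⟩, ⟨e₃⟩, hs⟩ := exists_isSyzygy_of_shortExact hT hX hZ
          exact ⟨_, ⟨T', hT', (gproj A).prop_of_iso e₁ hX', (gproj A).prop_of_iso e₃ hZ', rfl⟩, hs⟩
        exists_cosyzygy := by
          rintro _ ⟨T, hT, h₁, h₃, rfl⟩
          obtain ⟨X', hX', hX⟩ := hG.exists_cosyzygy _ h₁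
          obtain ⟨Z', hZ', hZ⟩ := hG.exists_cosyzygy _ h₃
          obtain ⟨T', hT', ⟨e₁⟩, ⟨e₃⟩, hs⟩ :=
            exists_isSyzygy_of_shortExact' hT (hG.ext _ h₃) hX hZ
          exact ⟨_, ⟨T', hT', (gproj A).prop_of_iso e₁ hX', (gproj A).prop_of_iso e₃ hZ', rfl⟩,
            hs⟩ }
    exact h.gproj ⟨T, hT, h₁, h₃, rfl⟩

end Syzygy

section GprojFrobenius

variable {A : Type u} [Category.{v} A] [Abelian A]

/-! ### The exact structure on the Gorenstein projective objects -/

theorem admissibleMono_gprojExact_iff {X Y : GprojCat A} (f : X ⟶ Y) :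
    AdmissibleMono (gprojExact A) f ↔ ∃ (Z : A) (g : Y.obj ⟶ Z) (w : f.hom ≫ g = 0),
      gproj A Z ∧ (ShortComplex.mk f.hom g w).ShortExact := by
  constructor
  · rintro ⟨Z, g, w, h⟩
    exact ⟨Z.obj, g.hom, congrArg InducedCategory.Hom.hom w, Z.property, h⟩
  · rintro ⟨Z, g, w, hZ, h⟩
    exact ⟨⟨Z, hZ⟩, ObjectProperty.homMk g, ObjectProperty.hom_ext _ w, h⟩

theorem admissibleEpi_gprojExact_iff {Y Z : GprojCat A} (g : Y ⟶ Z) :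
    AdmissibleEpi (gprojExact A) g ↔ ∃ (X : A) (f : X ⟶ Y.obj) (w : f ≫ g.hom = 0),
      gproj A X ∧ (ShortComplex.mk f g.hom w).ShortExact := by
  constructor
  · rintro ⟨X, f, w, h⟩
    exact ⟨X.obj, f.hom, congrArg InducedCategory.Hom.hom w, X.property, h⟩
  · rintro ⟨X, f, w, hX, h⟩
    exact ⟨⟨X, hX⟩, ObjectProperty.homMk f, ObjectProperty.hom_ext _ w, h⟩

instance : HasBinaryBiproducts (GprojCat A) where
  has_binary_biproduct X Y := by
    let b : BinaryBicone X Y :=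
      { pt := ⟨X.obj ⊞ Y.obj, (gproj A).prop_biprod X.property Y.property⟩
        fst := ObjectProperty.homMk biprod.fst
        snd := ObjectProperty.homMk biprod.snd
        inl := ObjectProperty.homMk biprod.inl
        inr := ObjectProperty.homMk biprod.inr
        inl_fst := ObjectProperty.hom_ext _ biprod.inl_fst
        inl_snd := ObjectProperty.hom_ext _ biprod.inl_snd
        inr_fst := ObjectProperty.hom_ext _ biprod.inr_fst
        inr_snd := ObjectProperty.hom_ext _ biprod.inr_snd }
    exact hasBinaryBiproduct_of_total b (ObjectProperty.hom_ext _ biprod.total)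

theorem hasFiniteBiproducts_gprojCat : HasFiniteBiproducts (GprojCat A) := by
  have : HasTerminal (GprojCat A) := HasZeroObject.hasTerminal
  have := hasFiniteProducts_of_has_binary_and_terminal (C := GprojCat A)
  exact HasFiniteBiproducts.of_hasFiniteProducts

variable (A) in
theorem isExactStructure_gprojExact : IsExactStructure (gprojExact A) where
  hasZeroObject := inferInstance
  hasFiniteBiproducts := hasFiniteBiproducts_gprojCat
  kernel T hT := by
    have := hT.mono_f
    have : Mono T.f := (gproj A).ι.mono_of_mono_map this
    exact ⟨KernelFork.IsLimit.ofι' _ _ fun {W} k hk =>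
      ⟨ObjectProperty.homMk (hT.exact.lift k.hom (congrArg InducedCategory.Hom.hom hk)),
        ObjectProperty.hom_ext _ (hT.exact.lift_f _ _)⟩⟩
  cokernel T hT := by
    have := hT.epi_g
    have : Epi T.g := (gproj A).ι.epi_of_epi_map this
    exact ⟨CokernelCofork.IsColimit.ofπ' _ _ fun {W} k hk =>
      ⟨ObjectProperty.homMk (hT.exact.desc k.hom (congrArg InducedCategory.Hom.hom hk)),
        ObjectProperty.hom_ext _ (hT.exact.g_desc _ _)⟩⟩
  of_iso T T' e hT := ShortComplex.shortExact_of_iso ((gproj A).ι.mapShortComplex.mapIso e) hT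
  ex0 Z hZ := (admissibleEpi_gprojExact_iff _).2 ⟨Z.obj, 0, zero_comp, Z.property,
    .mk' ((ShortComplex.exact_iff_mono _ rfl).2 (inferInstanceAs (Mono (𝟙 Z.obj))))
      ⟨fun _ _ _ => ((gproj A).ι.map_isZero hZ).eq_of_tgt _ _⟩
      (inferInstanceAs (Epi (𝟙 Z.obj)))⟩
  ex1 {X Y Z} f g hf hg := by
    rw [admissibleEpi_gprojExact_iff] at hf hg ⊢
    obtain ⟨K, i, w, hK, hs⟩ := hf
    obtain ⟨L, j, w', hL, hs'⟩ := hg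
    obtain ⟨M, k, wk, a, b, wab, hM, hab⟩ := exists_shortExact_kernel_comp hs hs'
    exact ⟨M, k, wk, (gproj A).prop_X₂_of_shortExact hab hK hL, hM⟩
  ex2 {B C C'} g h hg := by
    obtain ⟨K, i, w, hK, hs⟩ := (admissibleEpi_gprojExact_iff g).1 hg
    obtain ⟨k, wk, hk⟩ := shortExact_of_isPullback hs (IsPullback.of_hasPullback g.hom h.hom)
    refine ⟨⟨pullback g.hom h.hom, (gproj A).prop_X₂_of_shortExact hk hK C'.property⟩,
      ObjectProperty.homMk (pullback.fst _ _), ObjectProperty.homMk (pullback.snd _ _), ?_,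
      (admissibleEpi_gprojExact_iff _).2 ⟨K, k, wk, hK, hk⟩⟩
    exact IsPullback.of_map (gproj A).ι (ObjectProperty.hom_ext _ pullback.condition)
      (IsPullback.of_hasPullback g.hom h.hom)
  ex2_op {B C A'} f h hf := by
    obtain ⟨K, i, w, hK, hs⟩ := (admissibleMono_gprojExact_iff f).1 hf
    obtain ⟨k, wk, hk⟩ := shortExact_of_isPushout hs (IsPushout.of_hasPushout f.hom h.hom)
    refine ⟨⟨pushout f.hom h.hom, (gproj A).prop_X₂_of_shortExact hk A'.property hK⟩,
      ObjectProperty.homMk (pushout.inl _ _), ObjectProperty.homMk (pushout.inr _ _), ?_,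
      (admissibleMono_gprojExact_iff _).2 ⟨K, k, wk, hK, hk⟩⟩
    exact IsPushout.of_map (gproj A).ι (ObjectProperty.hom_ext _ pushout.condition)
      (IsPushout.of_hasPushout f.hom h.hom)

theorem exists_projective_admissibleEpi (X : GprojCat A) :
    ∃ (P : GprojCat A) (g : P ⟶ X), Projective P.obj ∧ AdmissibleEpi (gprojExact A) g := by
  have := HasExt.standard A
  obtain ⟨X', hX', P, i, p, w, hP, hs⟩ := isSyzygyStable_gproj.exists_syzygy X.obj X.property
  exact ⟨⟨P, gproj_of_projective hP⟩, ObjectProperty.homMk p, hP,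
    (admissibleEpi_gprojExact_iff _).2 ⟨X', i, w, hX', hs⟩⟩

theorem exists_projective_admissibleMono (X : GprojCat A) :
    ∃ (P : GprojCat A) (f : X ⟶ P), Projective P.obj ∧ AdmissibleMono (gprojExact A) f := by
  have := HasExt.standard A
  obtain ⟨X', hX', P, i, p, w, hP, hs⟩ := isSyzygyStable_gproj.exists_cosyzygy X.obj X.property
  exact ⟨⟨P, gproj_of_projective hP⟩, ObjectProperty.homMk i, hP,
    (admissibleMono_gprojExact_iff _).2 ⟨X', p, w, hX', hs⟩⟩

theorem relProjective_gprojExact_iff (X : GprojCat A) :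
    RelProjective (gprojExact A) X ↔ Projective X.obj := by
  constructor
  · intro hX
    obtain ⟨P, g, hP, hg⟩ := exists_projective_admissibleEpi X
    obtain ⟨s, hs⟩ := hX g (𝟙 X) hg
    exact Retract.projective (Y := P.obj) ⟨s.hom, g.hom, congrArg InducedCategory.Hom.hom hs⟩
  · intro hX Y Z g a hg
    obtain ⟨K, i, w, hK, hs⟩ := (admissibleEpi_gprojExact_iff g).1 hg
    have : Epi g.hom := hs.epi_g
    exact ⟨ObjectProperty.homMk (Projective.factorThru a.hom g.hom),
      ObjectProperty.hom_ext _ (Projective.factorThru_comp _ _)⟩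

/-- The projective objects of the abelian category are injective relative to the Gorenstein
projective objects, since the latter are orthogonal to the former. -/
theorem relInjective_gprojExact_iff (X : GprojCat A) :
    RelInjective (gprojExact A) X ↔ Projective X.obj := by
  constructor
  · intro hX
    obtain ⟨P, f, hP, hf⟩ := exists_projective_admissibleMono X
    obtain ⟨r, hr⟩ := hX f (𝟙 X) hf
    exact Retract.projective (Y := P.obj) ⟨f.hom, r.hom, congrArg InducedCategory.Hom.hom hr⟩
  · intro hX Y Z f a hf
    have := HasExt.standard A
    obtain ⟨K, i, w, hK, hs⟩ := (admissibleMono_gprojExact_iff f).1 hf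
    obtain ⟨b, hb⟩ := (isSyzygyStable_gproj.ext K hK).exists_extension hs hX a.hom
    exact ⟨ObjectProperty.homMk b, ObjectProperty.hom_ext _ hb⟩

variable (A) in
theorem isFrobenius_gprojExact : IsFrobenius (gprojExact A) where
  toIsExactStructure := isExactStructure_gprojExact A
  enoughProjectives X := by
    obtain ⟨P, g, hP, hg⟩ := exists_projective_admissibleEpi X
    exact ⟨P, g, fun {_ _} => (relProjective_gprojExact_iff P).2 hP, hg⟩
  enoughInjectives X := by
    obtain ⟨P, f, hP, hf⟩ := exists_projective_admissibleMono X
    exact ⟨P, f, fun {_ _} => (relInjective_gprojExact_iff P).2 hP, hf⟩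
  projective_iff_injective X := by
    rw [relProjective_gprojExact_iff, relInjective_gprojExact_iff]

theorem containsProj_iff (D : ObjectProperty (GprojCat A)) :
    ContainsProj D ↔ ∀ J, RelInjective (gprojExact A) J → D J := by
  constructor
  · intro h J hJ
    obtain ⟨_, hD⟩ := h J.obj ((relInjective_gprojExact_iff J).1 hJ)
    exact hD
  · intro h P hP
    exact ⟨gproj_of_projective hP, h _ ((relInjective_gprojExact_iff _).2 hP)⟩

end GprojFrobenius

end Gproj

theorem mainTheorem4 (A : Type u) [Category.{v} A] [Abelian A] [EnoughProjectives A] :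
    ∃ hF : Gproj.IsFrobenius (Gproj.gprojExact A),
      (Set.BijOn (Gproj.subToStable (Gproj.gprojExact A))
          {D | Gproj.IsThick (Gproj.gprojExact A) D ∧ Gproj.ContainsProj D}
          {D | Gproj.IsThickTriangulatedSub hF D} ∧
        Set.InvOn (Gproj.subOfStable (Gproj.gprojExact A))
          (Gproj.subToStable (Gproj.gprojExact A))
          {D | Gproj.IsThick (Gproj.gprojExact A) D ∧ Gproj.ContainsProj D}
          {D | Gproj.IsThickTriangulatedSub hF D}) ∧
      (Set.BijOn (Gproj.subToStable (Gproj.gprojExact A))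
          {D | Gproj.IsComplete (Gproj.gprojExact A) D ∧ Gproj.ContainsProj D}
          {D | Gproj.IsTriangulatedSub hF D} ∧
        Set.InvOn (Gproj.subOfStable (Gproj.gprojExact A))
          (Gproj.subToStable (Gproj.gprojExact A))
          {D | Gproj.IsComplete (Gproj.gprojExact A) D ∧ Gproj.ContainsProj D}
          {D | Gproj.IsTriangulatedSub hF D}) := by
  refine ⟨Gproj.isFrobenius_gprojExact A, ⟨?_, Gproj.invOn_subOfStable_subToStable _ _⟩,
    ⟨?_, Gproj.invOn_subOfStable_subToStable _ _⟩⟩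
  · refine (Gproj.invOn_subOfStable_subToStable _ _).bijOn ?_ ?_
    · exact fun D hD => hD.1.isThickTriangulatedSub _ ((Gproj.containsProj_iff D).1 hD.2)
    · exact fun D hD => ⟨hD.isThick, (Gproj.containsProj_iff _).2
        fun _ hJ => hD.toIsTriangulatedSub.of_relInjective hJ⟩
  · refine (Gproj.invOn_subOfStable_subToStable _ _).bijOn ?_ ?_
    · exact fun D hD => hD.1.isTriangulatedSub _ ((Gproj.containsProj_iff D).1 hD.2)
    · exact fun D hD => ⟨hD.isComplete, (Gproj.containsProj_iff _).2
        fun _ hJ => hD.of_relInjective hJ⟩
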